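/- Let $X_1,\dots,X_n$ be independent Bernoulli random variables with $\mathbb P\{X_j=1\}=p_j$ and $\mathbb P\{X_j=0\}=1-p_j$, where $p_j\in[0,1]$, and let $W=X_1+\dots+X_n$. Put $\lambda=p_1+\dots+p_n$ and $\lambda_2=p_1^2+\dots+p_n^2$, and let $Z$ be a Poisson random variable with parameter $\lambda$. Write $w_k=\mathbb P\{W=k\}$ and $v_k=\mathbb P\{Z=k\}=\frac{\lambda^k}{k!}e^{-\lambda}$ for $k=0,1,2,\dots$, and let $$D(W\|Z)=\sum_{k=0}^\infty w_k\log\frac{w_k}{v_k},\qquad \chi^2(W,Z)=\sum_{k=0}^\infty\frac{(w_k-v_k)^2}{v_k}$$ be the relative entropy (Kullback–Leibler divergence) and the Pearson $\chi^2$-divergence of the law of $W$ from the law of $Z$ (with $0\log 0=0$). If $\lambda\ge 1/2$ and $\lambda_2\le\kappa\lambda$ with $\kappa\in(0,1)$, then $$\frac14\Big(\frac{\lambda_2}{\lambda}\Big)^2\;\le\; D(W\|Z)\;\le\;\chi^2(W,Z)\;\le\; c\,(1-\kappa)^{-3}\Big(\frac{\lambda_2}{\lambda}\Big)^2,\qquad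 c=7\cdot 10^6 .$$ -/

import Mathlib

open MeasureTheory ProbabilityTheory
open scoped ENNReal

/-- The Pearson `χ²`-divergence `∑ₖ (μ{k} - ν{k})² / ν{k}` of two laws on `ℕ`, as an extended
nonnegative number (so a divergent series has the value `∞`; a term with `ν{k} = 0` is `0` if
`μ{k} = 0` and `∞` otherwise). -/
noncomputable def chiSqDiv (μ ν : Measure ℕ) : ℝ≥0∞ :=
  ∑' k : ℕ, ENNReal.ofReal ((μ.real {k} - ν.real {k}) ^ 2) / ν {k}

/-! Lower bound. By the Donsker–Varadhan principle (`le_klDiv_of_sum_exp_le`), D(W‖Z) ≥ E g(W) − log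
E exp g(Z) for a test function g. Here g is −c/2 times the second Poisson–Charlier polynomial k² −
(2λ+1)k + λ². The moments of W give E g(W) = cλ₂/2, and `sum_poisson_exp_charlier_le` gives log E
exp g(Z) ≤ c²λ²/4 for 0 < c ≤ 2. The choice c = λ₂/λ² yields (λ₂/λ)²/4. The exponential moment is a
deformed exponential series f with f'(x) = f(e^{-c}x), estimated along the curve x = m e^{cm} in
`deformedExpSum_le`.

Upper bounds. D ≤ χ² holds pointwise, by `klFun_le_sq`. Up to a constant factor, χ² is the squared
Bargmann–Fock norm of the difference of the generating functions
(`tsum_factorial_eq_lintegral_gaussian`). Recentring at z = 1 + u turns it into the Gaussian mean of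
|∏(1 + pⱼu)e^{-pⱼu} − 1|². The linear terms in u cancel, so this modulus is at most 2(exp(λ₂|u|²/2)
− 1), and explicit Gaussian integrals give 4λ₂²/((λ−λ₂)(2λ−λ₂)). -/

/-! ### Exponential moment of the second Charlier polynomial. -/

/-- Partial sums of the deformed exponential `∑ₖ xᵏ / k! · exp (-c k (k - 1) / 2)`. -/
noncomputable def deformedExpSum (c : ℝ) (N : ℕ) (x : ℝ) : ℝ :=
  ∑ k ∈ Finset.range N, x ^ k / k.factorial * Real.exp (-c * (k * (k - 1) / 2))

/-- Since (k+1)k/2 = k + k(k−1)/2, lowering the index leaves a factor e^{-ck}, which is absorbed by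
rescaling the argument. -/
theorem hasDerivAt_deformedExpSum (c : ℝ) (N : ℕ) (x : ℝ) :
    HasDerivAt (deformedExpSum c (N + 1)) (deformedExpSum c N (Real.exp (-c) * x)) x := by
  have h : deformedExpSum c (N + 1) = fun x ↦ (∑ k ∈ Finset.range N,
      x ^ (k + 1) / (k + 1).factorial * Real.exp (-c * ((k + 1 : ℕ) * ((k + 1 : ℕ) - 1) / 2)))
      + 1 := by
    funext x; simp [deformedExpSum, Finset.sum_range_succ']
  rw [h]
  refine HasDerivAt.add_const _ ?_
  refine HasDerivAt.fun_sum fun k _ ↦ ?_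
  have := ((hasDerivAt_pow (k + 1) x).div_const ((k + 1).factorial : ℝ)).mul_const
    (Real.exp (-c * ((k + 1 : ℕ) * ((k + 1 : ℕ) - 1) / 2)))
  convert! this using 1
  rw [mul_pow, ← Real.exp_nat_mul]
  have e : Real.exp (-c * ((k + 1 : ℕ) * ((k + 1 : ℕ) - 1) / 2)) =
      Real.exp (k * -c) * Real.exp (-c * (k * (k - 1) / 2)) := by
    rw [← Real.exp_add]; congr 1; push_cast; ring
  rw [e, Nat.factorial_succ]
  push_cast
  have : (k.factorial : ℝ) ≠ 0 := by positivity
  have : (k : ℝ) + 1 ≠ 0 := by positivity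
  field_simp

theorem two_mul_sub_one_sub_exp_neg_le {l : ℝ} (hl : 0 ≤ l) :
    2 * (l - (1 - Real.exp (-l))) ≤ l ^ 2 := by
  have h := Real.quadratic_le_exp_of_nonneg hl
  have e : Real.exp l * Real.exp (-l) = 1 := by rw [← Real.exp_add]; simp
  nlinarith [Real.exp_pos (-l), Real.exp_pos l, sq_nonneg (l ^ 2),
    mul_le_mul_of_nonneg_right h (Real.exp_pos (-l)).le]

theorem two_mul_mul_exp_neg_le {l : ℝ} (hl : 0 ≤ l) :
    2 * l * Real.exp (-l) ≤ 1 - Real.exp (-l) ^ 2 := by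
  have h := Real.self_le_sinh_iff.2 hl
  rw [Real.sinh_eq] at h
  have e : Real.exp l * Real.exp (-l) = 1 := by rw [← Real.exp_add]; simp
  nlinarith [Real.exp_pos (-l)]

theorem exp_neg_one_le : Real.exp (-1) ≤ 0.368 := by
  have h := Real.exp_one_gt_d9
  have e : Real.exp 1 * Real.exp (-1) = 1 := by rw [← Real.exp_add]; simp
  nlinarith [Real.exp_pos (-1)]

theorem exp_neg_two_le : Real.exp (-2) ≤ 0.136 := by
  have e : Real.exp (-2) = Real.exp (-1) * Real.exp (-1) := by rw [← Real.exp_add]; norm_num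
  have := exp_neg_one_le
  rw [e]
  nlinarith [Real.exp_pos (-1)]

theorem sq_div_two_le_one_sub_exp_neg_sq {l : ℝ} (hl : 0 ≤ l) (hl' : l ≤ 13 / 10) :
    l ^ 2 / 2 ≤ 1 - Real.exp (-l) ^ 2 := by
  have e : Real.exp (-l) ^ 2 = Real.exp (-(2 * l)) := by
    rw [← Real.exp_nat_mul]; congr 1; push_cast; ring
  -- On [0, 13/10] the convex function e^{-2l} lies below its chord; the resulting linear lower
  -- bound for 1 − e^{-2l} still dominates l²/2 there.
  have h := convexOn_exp.2 (Set.mem_univ (0 : ℝ)) (Set.mem_univ (-(13 / 5) : ℝ))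
    (show 0 ≤ 1 - l / (13 / 10) by linarith) (show 0 ≤ l / (13 / 10) by positivity) (by ring)
  simp only [smul_eq_mul, mul_zero, zero_add, Real.exp_zero, mul_one] at h
  rw [show l / (13 / 10) * -(13 / 5) = -(2 * l) by ring] at h
  have h2 : Real.exp (-(13 / 5)) ≤ 0.136 :=
    (Real.exp_le_exp.2 (by norm_num)).trans exp_neg_two_le
  rw [e]
  have h3 := mul_le_mul_of_nonneg_left h2 (by positivity : 0 ≤ l / (13 / 10))
  nlinarith

theorem sub_sq_div_two_le_log_one_add {x : ℝ} (hx : 0 ≤ x) :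
    x - x ^ 2 / 2 ≤ Real.log (1 + x) := by
  refine le_trans ?_ (Real.le_log_one_add_of_nonneg hx)
  rw [le_div_iff₀ (by positivity)]
  nlinarith [pow_nonneg hx 3]

/-- This is the logarithm of the derivative comparison needed in `deformedExpSum_le`, where the
shift l carries the curve parameter m to m e^{-l}. -/
theorem deformed_increment_le {c m l p : ℝ} (hc : 0 < c) (hc2 : c ≤ 2) (hm : 0 ≤ m) (hl : 0 ≤ l)
    (hp : p = 1 - Real.exp (-l)) (h : c = l + c * m * p) :
    c * m - m * p - (c / 2 + c ^ 2 / 4) * (m ^ 2 * (p * (2 - p))) ≤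
      Real.log (1 + c * (c * m) / (2 * (1 + c * m))) := by
  obtain ⟨α, hα⟩ : ∃ α, α = c * m := ⟨_, rfl⟩
  have hα0 : 0 ≤ α := by rw [hα]; positivity
  rw [← hα] at h ⊢
  refine le_trans ?_ (sub_sq_div_two_le_log_one_add (by positivity))
  have T : 0 ≤ l ^ 2 - 2 * (l - p) := by
    have := two_mul_sub_one_sub_exp_neg_le hl; rw [hp]; linarith
  obtain ⟨q, hq⟩ : ∃ q, q = p * (2 - p) := ⟨_, rfl⟩
  have hqe : q = 1 - Real.exp (-l) ^ 2 := by rw [hq, hp]; ring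
  have F : 0 ≤ q - 2 * l * (1 - p) := by
    have := two_mul_mul_exp_neg_le hl
    rw [hqe, hp]; linarith
  have hpl : p ≤ l := by rw [hp]; linarith [Real.add_one_le_exp (-l)]
  -- After log(1+x) ≥ x − x²/2 and clearing denominators, the terms of first order in x cancel. The
  -- loss x²/2 must be paid by three nonnegative gains.
  have key : c ^ 2 * α ^ 2 ≤
      4 * (1 + α) * (m * (l ^ 2 - 2 * (l - p)) + m * α * (q - 2 * l * (1 - p)) +
        α ^ 2 * (1 + α) * q / 2) := by
    have F' : 0 ≤ m * α * (q - 2 * l * (1 - p)) := by positivity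
    rcases le_total l (13 / 10) with h13 | h13
    · have hq2 : l ^ 2 / 2 ≤ q := hqe ▸ sq_div_two_le_one_sub_exp_neg_sq hl h13
      have hcl : c ≤ l * (1 + α) := by nlinarith
      have : c ^ 2 ≤ (l * (1 + α)) ^ 2 := pow_le_pow_left₀ hc.le hcl 2
      calc c ^ 2 * α ^ 2 ≤ (l * (1 + α)) ^ 2 * α ^ 2 := by gcongr
        _ = 4 * (1 + α) * (α ^ 2 * (1 + α) * (l ^ 2 / 2) / 2) := by ring
        _ ≤ 4 * (1 + α) * (α ^ 2 * (1 + α) * q / 2) := by gcongr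
        _ ≤ _ := by
          gcongr
          have : 0 ≤ m * (l ^ 2 - 2 * (l - p)) := by positivity
          linarith
    -- For large l the third gain alone no longer suffices. Here c ≤ 2 bounds the left side and
    -- makes m ≥ α/2, so the first gain covers small α.
    · have h1 : Real.exp (-l) ≤ 0.368 :=
        (Real.exp_le_exp.2 (by linarith)).trans exp_neg_one_le
      have h2 : Real.exp (-l) ^ 2 ≤ 0.136 := by
        nlinarith [Real.exp_pos (-l)]
      have hT : 0.354 ≤ l ^ 2 - 2 * (l - p) := by rw [hp]; nlinarith
      have hq' : 0.864 ≤ q := by rw [hqe]; linarith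
      have hmα : α / 2 ≤ m := by nlinarith
      have c4 : c ^ 2 ≤ 4 := by nlinarith
      calc c ^ 2 * α ^ 2 ≤ 4 * α ^ 2 := by gcongr
        _ ≤ 4 * (1 + α) * (α / 2 * 0.354 + 0 + α ^ 2 * (1 + α) * 0.864 / 2) := by
          have : 0 ≤ α * ((1 + α) * (0.177 + 0.432 * α + 0.432 * α ^ 2) - α) := by
            apply mul_nonneg hα0
            nlinarith [sq_nonneg (α - 0.25), pow_nonneg hα0 3]
          nlinarith
        _ ≤ _ := by gcongr
  have hcn := hc.ne'
  have h1α : 0 < 1 + α := by positivity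
  have e1 : α - m * p - (c / 2 + c ^ 2 / 4) * (m ^ 2 * q) =
      m * (l - p + α * p ^ 2 / 2) - α ^ 2 * q / 4 := by
    have : (c / 2 + c ^ 2 / 4) * (m ^ 2 * q) = α * m * q / 2 + α ^ 2 * q / 4 := by
      rw [hα]; ring
    have hα' : α = (l + α * p) * m := by rw [← h]; exact hα
    rw [this, hq]
    linear_combination hα'
  have e2 : m * (l - p + α * p ^ 2 / 2) * (2 * (1 + α)) =
      m * c ^ 2 - m * (l ^ 2 - 2 * (l - p)) - m * α * (q - 2 * l * (1 - p)) := by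
    rw [hq]
    linear_combination (-m * (c + (l + α * p))) * h
  rw [← hq, e1]
  have e3 : c * α / (2 * (1 + α)) - (c * α / (2 * (1 + α))) ^ 2 / 2 =
     (4 * (1 + α) * (c * α) - c ^ 2 * α ^ 2) / (8 * (1 + α) ^ 2) := by
    field_simp
    ring
  rw [e3, le_div_iff₀ (by positivity)]
  have e4 : c * α = m * c ^ 2 := by rw [hα]; ring
  rw [e4]
  nlinarith [congrArg (fun t ↦ t * (4 * (1 + α))) e2]

theorem exists_deformed_shift {c m : ℝ} (hc : 0 ≤ c) (hm : 0 ≤ m) :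
    ∃ l : ℝ, 0 ≤ l ∧ c = l + c * m * (1 - Real.exp (-l)) := by
  have hcont : ContinuousOn (fun l : ℝ ↦ l + c * m * (1 - Real.exp (-l))) (Set.Icc 0 c) := by
    fun_prop
  have := intermediate_value_Icc hc hcont
  have hcm : c ∈ Set.Icc (0 + c * m * (1 - Real.exp (-0))) (c + c * m * (1 - Real.exp (-c))) := by
    constructor
    · simpa using hc
    · have : Real.exp (-c) ≤ 1 := Real.exp_le_one_iff.2 (by linarith)
      have : 0 ≤ c * m * (1 - Real.exp (-c)) := by
        apply mul_nonneg (by positivity); linarith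
      linarith
  obtain ⟨l, hl, h⟩ := this hcm
  exact ⟨l, hl.1, h.symm⟩

/-- Both sides equal 1 at m = 0 when N > 0, so it suffices to compare derivatives in m. The
derivative of the sum involves one term fewer at e^{-c}x, a point of the same curve with parameter m
e^{-l}, so induction on N applies. -/
theorem deformedExpSum_le {c : ℝ} (hc : 0 < c) (hc2 : c ≤ 2) (N : ℕ) :
    ∀ m : ℝ, 0 ≤ m → deformedExpSum c N (m * Real.exp (c * m)) ≤
      Real.exp (m + (c / 2 + c ^ 2 / 4) * m ^ 2) := by
  induction N with
  | zero => intro m _; simp [deformedExpSum, Real.exp_nonneg]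
  | succ N ih =>
    have hx (m : ℝ) : HasDerivAt (fun m : ℝ ↦ m * Real.exp (c * m))
        (Real.exp (c * m) * (1 + c * m)) m := by
      have h1 : HasDerivAt (fun m : ℝ ↦ c * m) c m := by simpa using (hasDerivAt_id m).const_mul c
      convert! (hasDerivAt_id m).mul h1.exp using 1
      simp; ring
    have hH (m : ℝ) : HasDerivAt (fun m : ℝ ↦ Real.exp (m + (c / 2 + c ^ 2 / 4) * m ^ 2))
        (Real.exp (m + (c / 2 + c ^ 2 / 4) * m ^ 2) * (1 + (c + c ^ 2 / 2) * m)) m := by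
      have h1 := ((hasDerivAt_id m).add ((hasDerivAt_pow 2 m).const_mul (c / 2 + c ^ 2 / 4))).exp
      convert! h1 using 1
      simp; ring_nf
    have hd (m : ℝ) := (hH m).sub ((hasDerivAt_deformedExpSum c N _).comp m (hx m))
    have hmono : MonotoneOn (fun m : ℝ ↦ Real.exp (m + (c / 2 + c ^ 2 / 4) * m ^ 2) -
        deformedExpSum c (N + 1) (m * Real.exp (c * m))) (Set.Ici 0) := by
      refine monotoneOn_of_deriv_nonneg (convex_Ici 0)
        (fun m _ ↦ (hd m).continuousAt.continuousWithinAt)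
        (fun m _ ↦ (hd m).differentiableAt.differentiableWithinAt) ?_
      intro m hm
      rw [interior_Ici] at hm
      have hm0 : 0 ≤ m := le_of_lt hm
      refine le_of_le_of_eq ?_ (hd m).deriv.symm
      rw [sub_nonneg]
      obtain ⟨l, hl, hcl⟩ := exists_deformed_shift hc.le hm0
      have harg : Real.exp (-c) * (m * Real.exp (c * m)) =
          m * Real.exp (-l) * Real.exp (c * (m * Real.exp (-l))) := by
        have : Real.exp (-c) * (m * Real.exp (c * m)) = m * (Real.exp (-c + c * m)) := by
          rw [Real.exp_add]; ring
        rw [this, mul_assoc, ← Real.exp_add]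
        congr 2
        linear_combination -hcl
      have hlog := deformed_increment_le hc hc2 hm0 hl rfl hcl
      have hpos : 0 < 1 + c * m := by positivity
      have heps : 0 < 1 + c * (c * m) / (2 * (1 + c * m)) := by positivity
      rw [harg]
      calc _ ≤ Real.exp (m * Real.exp (-l) + (c / 2 + c ^ 2 / 4) * (m * Real.exp (-l)) ^ 2) *
            (Real.exp (c * m) * (1 + c * m)) := by
            gcongr
            exact ih _ (by positivity)
        _ = Real.exp (m + (c / 2 + c ^ 2 / 4) * m ^ 2) * (1 + c * m) *
            Real.exp (c * m - m * (1 - Real.exp (-l)) - (c / 2 + c ^ 2 / 4) *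
              (m ^ 2 * ((1 - Real.exp (-l)) * (2 - (1 - Real.exp (-l)))))) := by
            rw [← mul_assoc, ← Real.exp_add, mul_right_comm, ← Real.exp_add]
            congr 2
            ring
        _ ≤ Real.exp (m + (c / 2 + c ^ 2 / 4) * m ^ 2) * (1 + c * m) *
            (1 + c * (c * m) / (2 * (1 + c * m))) := by
            gcongr
            exact (Real.le_log_iff_exp_le heps).1 hlog
        -- The argument of the logarithm is exactly (1 + (c + c²/2)m)/(1 + cm), the ratio of the two
        -- derivative factors.
        _ = _ := by field_simp; ring
    intro m hm
    have := hmono (Set.mem_Ici.2 le_rfl) (Set.mem_Ici.2 hm) hm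
    simp only [zero_mul] at this
    have h1 : deformedExpSum c (N + 1) 0 = 1 := by
      simp [deformedExpSum, Finset.sum_range_succ']
    rw [h1] at this
    simp at this
    exact this

/-- A sub-Gaussian bound for the second Poisson-Charlier polynomial at negative arguments. -/
theorem sum_poisson_exp_charlier_le {lam c : ℝ} (hlam : 0 ≤ lam) (hc : 0 < c) (hc2 : c ≤ 2)
    (N : ℕ) :
    ∑ k ∈ Finset.range N, Real.exp (-lam) * lam ^ k / k.factorial *
      Real.exp (-(c / 2) * ((k : ℝ) ^ 2 - (2 * lam + 1) * k + lam ^ 2)) ≤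
      Real.exp (c ^ 2 * lam ^ 2 / 4) := by
  -- As k² − (2λ+1)k = k(k−1) − 2λk, the tilted Poisson weights are deformed exponential terms at x
  -- = λe^{cλ}.
  have h := deformedExpSum_le hc hc2 N lam hlam
  have h2 := mul_le_mul_of_nonneg_left h (Real.exp_nonneg (-lam - c * lam ^ 2 / 2))
  refine le_of_eq_of_le ?_ (h2.trans_eq ?_)
  · rw [deformedExpSum, Finset.mul_sum]
    refine Finset.sum_congr rfl fun k _ ↦ ?_
    rw [mul_pow, ← Real.exp_nat_mul]
    have : Real.exp (-(c / 2) * ((k : ℝ) ^ 2 - (2 * lam + 1) * k + lam ^ 2)) =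
        Real.exp (- (c * lam ^ 2 / 2)) * Real.exp (k * (c * lam)) *
          Real.exp (-c * (k * (k - 1) / 2)) := by
      rw [← Real.exp_add, ← Real.exp_add]; congr 1; ring
    rw [this, sub_eq_add_neg (-lam), Real.exp_add]
    ring
  · rw [← Real.exp_add]; congr 1; ring

/-! ### Power series and the Bargmann–Fock norm. -/

/-- Parseval's identity on the unit circle for absolutely summable power series. -/
theorem hasSum_sq_norm_circleAverage {f : ℕ → ℂ} (hf : Summable fun k ↦ ‖f k‖) :
    HasSum (fun k ↦ ‖f k‖ ^ 2)
      (Real.circleAverage (fun z ↦ ‖∑' k, f k * z ^ k‖ ^ 2) 0 1) := by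
  -- Parseval is known for the polynomial truncations; dominated convergence with the constant (∑‖f
  -- k‖)² passes to the limit.
  set p : ℕ → Polynomial ℂ := fun N ↦ ∑ k ∈ Finset.range N, Polynomial.monomial k (f k) with hp
  have hcoeff (N k : ℕ) : (p N).coeff k = if k < N then f k else 0 := by
    simp [hp, Polynomial.finsetSum_coeff, Polynomial.coeff_monomial]
  have heval (N : ℕ) (z : ℂ) : (p N).eval z = ∑ k ∈ Finset.range N, f k * z ^ k := by
    simp [hp, Polynomial.eval_finsetSum]
  have hpars (N : ℕ) : ∑ k ∈ Finset.range N, ‖f k‖ ^ 2 =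
      Real.circleAverage (fun z ↦ ‖∑ k ∈ Finset.range N, f k * z ^ k‖ ^ 2) 0 1 := by
    have := (p N).sum_sq_norm_coeff_eq_circleAverage
    simp only [heval] at this
    rw [← this]
    symm
    apply Finset.sum_subset_zero_on_sdiff
    · intro k hk
      rw [Polynomial.mem_support_iff, hcoeff] at hk
      simpa using (ite_ne_right_iff.1 hk).1
    · intro k hk
      rw [Finset.mem_sdiff, Polynomial.notMem_support_iff, hcoeff, Finset.mem_range] at hk
      have := hk.2
      rw [if_pos hk.1] at this
      simp [this]
    · intro k hk
      rw [Polynomial.mem_support_iff, hcoeff] at hk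
      rw [hcoeff, if_pos (ite_ne_right_iff.1 hk).1]
  have hsum (z : ℂ) (hz : ‖z‖ = 1) : Summable fun k ↦ f k * z ^ k := by
    refine Summable.of_norm ?_
    simpa [hz] using hf
  rw [hasSum_iff_tendsto_nat_of_nonneg (fun k ↦ by positivity)]
  simp only [hpars, Real.circleAverage]
  refine Filter.Tendsto.const_smul ?_ _
  refine intervalIntegral.tendsto_integral_filter_of_dominated_convergence
    (fun _ ↦ (∑' k, ‖f k‖) ^ 2) ?_ ?_ ?_ ?_
  · refine Filter.Eventually.of_forall fun N ↦ ?_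
    apply Continuous.aestronglyMeasurable
    fun_prop
  · refine Filter.Eventually.of_forall fun N ↦ Filter.Eventually.of_forall fun θ _ ↦ ?_
    rw [norm_pow, norm_norm]
    gcongr
    refine (norm_sum_le _ _).trans ?_
    simp only [norm_mul, norm_pow, norm_circleMap_zero, abs_one, one_pow, mul_one]
    exact hf.sum_le_tsum _ (fun _ _ ↦ norm_nonneg _)
  · exact intervalIntegrable_const
  · refine Filter.Eventually.of_forall fun θ _ ↦ ?_
    refine Filter.Tendsto.pow (Filter.Tendsto.norm ?_) 2
    exact (hsum _ (by simp)).hasSum.tendsto_sum_nat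

/-- Parseval for the coefficients f k · r^k. The period is shifted to (−π, π) to match the range of
polar coordinates. -/
theorem tsum_sq_norm_mul_pow_eq_lintegral {f : ℕ → ℂ} {r : ℝ} (hr : 0 ≤ r)
    (hf : Summable fun k ↦ ‖f k‖ * r ^ k) :
    ∑' k, ENNReal.ofReal (‖f k‖ ^ 2 * r ^ (2 * k)) =
      ∫⁻ θ in Set.Ioo (-Real.pi) Real.pi, ENNReal.ofReal ((2 * Real.pi)⁻¹ *
        ‖∑' k, f k * (circleMap 0 r θ) ^ k‖ ^ 2) := by
  have hf' : Summable fun k ↦ ‖f k * (r : ℂ) ^ k‖ := by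
    simpa [abs_of_nonneg hr] using hf
  have h := hasSum_sq_norm_circleAverage hf'
  have hg (θ : ℝ) : ∑' k, f k * (r : ℂ) ^ k * (circleMap 0 1 θ) ^ k =
      ∑' k, f k * (circleMap 0 r θ) ^ k := by
    congr 1; funext k; simp [circleMap, mul_pow, mul_assoc]
  have hsq (k : ℕ) : ‖f k * (r : ℂ) ^ k‖ ^ 2 = ‖f k‖ ^ 2 * r ^ (2 * k) := by
    rw [norm_mul, norm_pow, mul_pow, ← pow_mul, mul_comm k 2]; simp [abs_of_nonneg hr]
  simp only [hsq, Real.circleAverage, hg, smul_eq_mul] at h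
  have hcont : Continuous fun θ : ℝ ↦ ‖∑' k, f k * (circleMap 0 r θ) ^ k‖ ^ 2 := by
    refine Continuous.pow (Continuous.norm ?_) 2
    refine continuous_tsum (u := fun k ↦ ‖f k‖ * r ^ k) (fun k ↦ by fun_prop) hf ?_
    intro k θ
    simp [abs_of_nonneg hr]
  have hper : Function.Periodic (fun θ : ℝ ↦ ‖∑' k, f k * (circleMap 0 r θ) ^ k‖ ^ 2)
      (2 * Real.pi) := fun θ ↦ by simp only [periodic_circleMap 0 r θ]
  have hshift := hper.intervalIntegral_add_eq 0 (-Real.pi)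
  rw [zero_add, show -Real.pi + 2 * Real.pi = Real.pi by ring] at hshift
  rw [hshift, intervalIntegral.integral_of_le (by linarith [Real.pi_pos]),
    integral_Ioc_eq_integral_Ioo, ← integral_const_mul] at h
  rw [← ofReal_integral_eq_lintegral_ofReal, ← h.tsum_eq,
    ENNReal.ofReal_tsum_of_nonneg (fun _ ↦ by positivity) h.summable]
  · refine Integrable.const_mul ?_ _
    exact (hcont.integrableOn_Icc (a := -Real.pi) (b := Real.pi)).mono_set Set.Ioo_subset_Icc_self
  · exact Filter.Eventually.of_forall fun θ ↦ by positivity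

/-- Averaging the circle identities over the radius with this weight produces the factors k!/b^k of
the Fock norm. -/
theorem lintegral_gaussian_moment {b : ℝ} (hb : 0 < b) (k : ℕ) :
    ∫⁻ r in Set.Ioi (0 : ℝ), ENNReal.ofReal (2 * b * (r * Real.exp (-b * r ^ 2)) * r ^ (2 * k)) =
      ENNReal.ofReal (k.factorial / b ^ k) := by
  have h1 := integral_rpow_mul_exp_neg_mul_rpow (p := 2) (q := 2 * k + 1) two_pos
    (by linarith [(Nat.cast_nonneg k : (0 : ℝ) ≤ k)]) hb
  have h2 := integrableOn_rpow_mul_exp_neg_mul_sq hb (s := 2 * k + 1)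
    (by linarith [(Nat.cast_nonneg k : (0 : ℝ) ≤ k)])
  have e (r : ℝ) : 2 * b * (r * Real.exp (-b * r ^ 2)) * r ^ (2 * k) =
      2 * b * (r ^ (2 * (k : ℝ) + 1) * Real.exp (-b * r ^ 2)) := by
    rw [show (2 * (k : ℝ) + 1) = ((2 * k + 1 : ℕ) : ℝ) by push_cast; ring, Real.rpow_natCast]
    ring
  simp only [Real.rpow_two] at h1
  simp only [e]
  rw [← ofReal_integral_eq_lintegral_ofReal (h2.const_mul _), integral_const_mul, h1]
  · congr 1
    rw [show (2 * (k : ℝ) + 1 + 1) / 2 = k + 1 by ring, Real.Gamma_nat_eq_factorial, neg_div,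
      show (2 * (k : ℝ) + 1 + 1) / 2 = ((k + 1 : ℕ) : ℝ) by push_cast; ring, Real.rpow_neg hb.le,
      Real.rpow_natCast]
    field_simp
    ring
  · filter_upwards [ae_restrict_mem measurableSet_Ioi] with r hr
    have : (0 : ℝ) < r := hr
    positivity

/-- The norm of the Bargmann-Fock space in terms of power series coefficients. -/
theorem tsum_factorial_eq_lintegral_gaussian {f : ℕ → ℂ} {b : ℝ} (hb : 0 < b)
    (hf : ∀ r : ℝ, 0 ≤ r → Summable fun k ↦ ‖f k‖ * r ^ k) :
    ∑' k, ENNReal.ofReal (‖f k‖ ^ 2 * (k.factorial / b ^ k)) =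
      ENNReal.ofReal (b / Real.pi) *
        ∫⁻ z : ℂ, ENNReal.ofReal (‖∑' k, f k * z ^ k‖ ^ 2 * Real.exp (-b * ‖z‖ ^ 2)) := by
  have hcont : Continuous fun z : ℂ ↦ ∑' k, f k * z ^ k := by
    rw [continuous_iff_continuousAt]
    intro z
    have : ContinuousOn (fun z : ℂ ↦ ∑' k, f k * z ^ k) (Metric.ball 0 (‖z‖ + 1)) := by
      refine continuousOn_tsum (fun k ↦ by fun_prop) (hf (‖z‖ + 1) (by positivity)) ?_
      intro k w hw
      rw [norm_mul, norm_pow]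
      gcongr
      simpa using (mem_ball_zero_iff.1 hw).le
    refine this.continuousAt (Metric.isOpen_ball.mem_nhds ?_)
    simp
  have hmeas : Measurable fun x : ℝ × ℝ ↦ ENNReal.ofReal (2 * b * (x.1 * Real.exp (-b * x.1 ^ 2))) *
      ENNReal.ofReal ((2 * Real.pi)⁻¹ * ‖∑' k, f k * (circleMap 0 x.1 x.2) ^ k‖ ^ 2) := by
    have h1 : Continuous fun x : ℝ × ℝ ↦ circleMap 0 x.1 x.2 := by
      unfold circleMap; fun_prop
    have h2 := hcont.comp h1
    have h3 : Continuous fun x : ℝ × ℝ ↦ ∑' k, f k * (circleMap 0 x.1 x.2) ^ k := h2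
    refine Measurable.fun_mul (by fun_prop) ?_
    exact ENNReal.measurable_ofReal.comp ((h3.norm.pow 2).const_mul _).measurable
  calc ∑' k, ENNReal.ofReal (‖f k‖ ^ 2 * (k.factorial / b ^ k))
      = ∑' k, ∫⁻ r in Set.Ioi (0 : ℝ), ENNReal.ofReal (‖f k‖ ^ 2) *
          ENNReal.ofReal (2 * b * (r * Real.exp (-b * r ^ 2)) * r ^ (2 * k)) := by
        refine tsum_congr fun k ↦ ?_
        rw [lintegral_const_mul _ (by fun_prop), lintegral_gaussian_moment hb,
          ENNReal.ofReal_mul (by positivity)]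
    _ = ∫⁻ r in Set.Ioi (0 : ℝ), ∑' k, ENNReal.ofReal (‖f k‖ ^ 2) *
          ENNReal.ofReal (2 * b * (r * Real.exp (-b * r ^ 2)) * r ^ (2 * k)) := by
        rw [lintegral_tsum fun k ↦ by fun_prop]
    _ = ∫⁻ r in Set.Ioi (0 : ℝ), ∫⁻ θ in Set.Ioo (-Real.pi) Real.pi,
          ENNReal.ofReal (2 * b * (r * Real.exp (-b * r ^ 2))) *
          ENNReal.ofReal ((2 * Real.pi)⁻¹ * ‖∑' k, f k * (circleMap 0 r θ) ^ k‖ ^ 2) := by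
        refine setLIntegral_congr_fun measurableSet_Ioi fun r hr ↦ ?_
        have hr : (0 : ℝ) < r := hr
        rw [lintegral_const_mul' _ _ ENNReal.ofReal_ne_top,
          ← tsum_sq_norm_mul_pow_eq_lintegral hr.le (hf r hr.le), ← ENNReal.tsum_mul_left]
        refine tsum_congr fun k ↦ ?_
        rw [← ENNReal.ofReal_mul (by positivity), ← ENNReal.ofReal_mul (by positivity)]
        congr 1; ring
    _ = ∫⁻ x in polarCoord.target,
          ENNReal.ofReal (2 * b * (x.1 * Real.exp (-b * x.1 ^ 2))) *
          ENNReal.ofReal ((2 * Real.pi)⁻¹ * ‖∑' k, f k * (circleMap 0 x.1 x.2) ^ k‖ ^ 2) := by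
        rw [polarCoord_target, Measure.volume_eq_prod, setLIntegral_prod _ hmeas.aemeasurable]
    _ = ∫⁻ x in polarCoord.target, ENNReal.ofReal x.1 • (fun z : ℂ ↦ ENNReal.ofReal (b / Real.pi) *
          ENNReal.ofReal (‖∑' k, f k * z ^ k‖ ^ 2 * Real.exp (-b * ‖z‖ ^ 2)))
          (Complex.polarCoord.symm x) := by
        refine setLIntegral_congr_fun polarCoord.open_target.measurableSet fun x hx ↦ ?_
        have hx1 : 0 < x.1 := by
          rw [polarCoord_target] at hx; exact hx.1
        have hz : Complex.polarCoord.symm x = circleMap 0 x.1 x.2 := by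
          simp [Complex.polarCoord_symm_apply, circleMap, Complex.exp_mul_I]
        simp only [hz, smul_eq_mul, norm_circleMap_zero, sq_abs]
        rw [← ENNReal.ofReal_mul (by positivity), ← ENNReal.ofReal_mul (by positivity),
          ← ENNReal.ofReal_mul (by positivity)]
        congr 1
        field_simp
    _ = _ := by
        refine (Complex.lintegral_comp_polarCoord_symm (fun z : ℂ ↦ ENNReal.ofReal (b / Real.pi) *
          ENNReal.ofReal (‖∑' k, f k * z ^ k‖ ^ 2 * Real.exp (-b * ‖z‖ ^ 2)))).trans ?_
        exact lintegral_const_mul' _ _ ENNReal.ofReal_ne_top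

/-! ### Gaussian estimate for the ratio of generating functions. -/

theorem integrable_complex_gaussian {b : ℝ} (hb : 0 < b) :
    Integrable fun z : ℂ ↦ Real.exp (-b * ‖z‖ ^ 2) := by
  -- A non-integrable function would have integral 0 by convention, but the known value is positive.
  by_contra h
  have h1 := Complex.integral_exp_neg_mul_rpow (p := 2) (by norm_num) hb
  simp only [Real.rpow_two] at h1
  rw [integral_undef h] at h1
  have h2 : 0 < Real.pi * b ^ (-2 / 2 : ℝ) * Real.Gamma (2 / 2 + 1) := by
    have := Real.Gamma_pos_of_pos (s := 2 / 2 + 1) (by norm_num)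
    positivity
  exact h2.ne h1

theorem integral_complex_gaussian {b : ℝ} (hb : 0 < b) :
    ∫ z : ℂ, Real.exp (-b * ‖z‖ ^ 2) = Real.pi / b := by
  have h1 := Complex.integral_exp_neg_mul_rpow (p := 2) (by norm_num) hb
  simp only [Real.rpow_two] at h1
  rw [h1, show (-2 / 2 : ℝ) = -1 by norm_num, Real.rpow_neg_one,
    show (2 / 2 + 1 : ℝ) = 2 by norm_num, Real.Gamma_two]
  ring

/-- |1+x|² = 1 + (2 Re x + |x|²) ≤ exp(2 Re x + |x|²), and |e^{-x}|² removes the linear part. -/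
theorem norm_one_add_mul_exp_neg_le (x : ℂ) :
    ‖(1 + x) * Complex.exp (-x)‖ ≤ Real.exp (‖x‖ ^ 2 / 2) := by
  refine (sq_le_sq₀ (norm_nonneg _) (Real.exp_nonneg _)).1 ?_
  have h1 : ‖1 + x‖ ^ 2 = 1 + (2 * x.re + ‖x‖ ^ 2) := by
    rw [Complex.sq_norm, Complex.sq_norm, Complex.normSq_apply, Complex.normSq_apply]
    simp; ring
  rw [norm_mul, mul_pow, h1, Complex.norm_exp, ← Real.exp_nat_mul, ← Real.exp_nat_mul]
  calc _ ≤ Real.exp (2 * x.re + ‖x‖ ^ 2) * Real.exp ((2 : ℕ) * (-x).re) := by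
        gcongr
        linarith [Real.add_one_le_exp (2 * x.re + ‖x‖ ^ 2)]
    _ = _ := by
        rw [← Real.exp_add]; congr 1; simp; ring

/-- Along t ↦ tx the derivative is −t x² e^{-tx}, and |e^{-tx}| ≤ e^{1/2} exp(t²|x|²/2) with e^{1/2}
≤ 2; integrate over [0, 1]. -/
theorem norm_one_add_mul_exp_neg_sub_one_le (x : ℂ) :
    ‖(1 + x) * Complex.exp (-x) - 1‖ ≤ 2 * (Real.exp (‖x‖ ^ 2 / 2) - 1) := by
  have hd (t : ℝ) : HasDerivAt (fun t : ℝ ↦ (1 + t * x) * Complex.exp (-(t * x)) - 1)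
      (-(t * x ^ 2) * Complex.exp (-(t * x))) t := by
    have h0 : HasDerivAt (fun t : ℝ ↦ (t : ℂ) * x) x t := by
      simpa using (Complex.ofRealCLM.hasDerivAt (x := t)).mul_const x
    convert! ((h0.const_add 1).mul h0.fun_neg.cexp).sub_const 1 using 1
    ring
  have hb (t : ℝ) : HasDerivAt (fun t : ℝ ↦ 2 * (Real.exp (t ^ 2 * (‖x‖ ^ 2 / 2)) - 1))
      (2 * (Real.exp (t ^ 2 * (‖x‖ ^ 2 / 2)) * (t * ‖x‖ ^ 2))) t := by
    have h0 := (((hasDerivAt_pow 2 t).mul_const (‖x‖ ^ 2 / 2)).exp.sub_const 1).const_mul 2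
    convert! h0 using 1
    simp; ring
  have h := image_norm_le_of_norm_deriv_right_le_deriv_boundary (a := 0) (b := 1)
    (fun t _ ↦ (hd t).continuousAt.continuousWithinAt)
    (fun t _ ↦ (hd t).hasDerivWithinAt) (by simp) hb ?_ (Set.right_mem_Icc.2 zero_le_one)
  · simpa using h
  · intro t ht
    have ht0 := ht.1
    rw [norm_mul, norm_neg, norm_mul, norm_pow, Complex.norm_exp, Complex.norm_real,
      Real.norm_of_nonneg ht0]
    have h1 : (-(t * x)).re ≤ 1 / 2 + t ^ 2 * (‖x‖ ^ 2 / 2) := by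
      have h2 : (-(t * x)).re ≤ t * ‖x‖ := by
        refine (Complex.re_le_norm _).trans ?_
        simp [abs_of_nonneg ht0]
      nlinarith [sq_nonneg (t * ‖x‖ - 1)]
    have h3 : Real.exp (1 / 2) ≤ 2 := by
      have h4 : Real.exp (1 / 2) ^ 2 = Real.exp 1 := by rw [← Real.exp_nat_mul]; norm_num
      nlinarith [Real.exp_one_lt_d9, Real.exp_pos (1 / 2)]
    calc t * ‖x‖ ^ 2 * Real.exp (-(t * x)).re
        ≤ t * ‖x‖ ^ 2 * (Real.exp (1 / 2) * Real.exp (t ^ 2 * (‖x‖ ^ 2 / 2))) := by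
          rw [← Real.exp_add]; gcongr
      _ ≤ t * ‖x‖ ^ 2 * (2 * Real.exp (t ^ 2 * (‖x‖ ^ 2 / 2))) := by gcongr
      _ = _ := by ring

theorem norm_prod_one_add_mul_exp_neg_sub_one_le {ι : Type*} (s : Finset ι) (x : ι → ℂ) :
    ‖∏ j ∈ s, ((1 + x j) * Complex.exp (-x j)) - 1‖ ≤
      2 * (Real.exp ((∑ j ∈ s, ‖x j‖ ^ 2) / 2) - 1) := by
  classical
  induction s using Finset.induction_on with
  | empty => simp
  | insert i s hi ih =>
    rw [Finset.prod_insert hi, Finset.sum_insert hi, add_div, Real.exp_add]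
    set E := (1 + x i) * Complex.exp (-x i)
    set G := ∏ j ∈ s, ((1 + x j) * Complex.exp (-x j))
    have h1 := norm_one_add_mul_exp_neg_le (x i)
    have h2 := norm_one_add_mul_exp_neg_sub_one_le (x i)
    -- The bound 2(e^s − 1) reproduces itself exactly: e^a · 2(e^b − 1) + 2(e^a − 1) = 2(e^{a+b} −
    -- 1).
    calc ‖E * G - 1‖ = ‖E * (G - 1) + (E - 1)‖ := by ring_nf
      _ ≤ ‖E‖ * ‖G - 1‖ + ‖E - 1‖ := (norm_add_le _ _).trans_eq (by rw [norm_mul])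
      _ ≤ Real.exp (‖x i‖ ^ 2 / 2) * (2 * (Real.exp ((∑ j ∈ s, ‖x j‖ ^ 2) / 2) - 1)) +
          2 * (Real.exp (‖x i‖ ^ 2 / 2) - 1) := by gcongr
      _ = _ := by ring

/-- Gaussian square norm of the ratio of the generating functions of a sum of independent
Bernoulli variables and of a Poisson variable, minus one, centred at `1`. -/
theorem lintegral_sq_norm_prod_sub_one_le {ι : Type*} [Fintype ι] (p : ι → ℝ) {lam lam₂ : ℝ}
    (hlam : 0 < lam) (hlam₂ : lam₂ = ∑ j, p j ^ 2) (hlt : lam₂ < lam) :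
    ENNReal.ofReal (lam / Real.pi) * ∫⁻ u : ℂ, ENNReal.ofReal
      (‖∏ j, ((1 + p j * u) * Complex.exp (-(p j * u))) - 1‖ ^ 2 *
        Real.exp (-lam * ‖u‖ ^ 2)) ≤
      ENNReal.ofReal (4 * lam₂ ^ 2 / ((lam - lam₂) * (2 * lam - lam₂))) := by
  have h0 : 0 ≤ lam₂ := by rw [hlam₂]; positivity
  have hpi := Real.pi_pos
  -- Expanding the squared majorant leaves three Gaussians; λ₂ < λ makes all of them integrable.
  set F : ℂ → ℝ := fun u ↦ 4 * (Real.exp (-(lam - lam₂) * ‖u‖ ^ 2) -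
    2 * Real.exp (-(lam - lam₂ / 2) * ‖u‖ ^ 2) + Real.exp (-lam * ‖u‖ ^ 2)) with hF
  have hFe (u : ℂ) : F u = (2 * (Real.exp (lam₂ * ‖u‖ ^ 2 / 2) - 1)) ^ 2 *
      Real.exp (-lam * ‖u‖ ^ 2) := by
    have e1 : Real.exp (-(lam - lam₂) * ‖u‖ ^ 2) = Real.exp (lam₂ * ‖u‖ ^ 2 / 2) ^ 2 *
        Real.exp (-lam * ‖u‖ ^ 2) := by
      rw [← Real.exp_nat_mul, ← Real.exp_add]; congr 1; push_cast; ring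
    have e2 : Real.exp (-(lam - lam₂ / 2) * ‖u‖ ^ 2) = Real.exp (lam₂ * ‖u‖ ^ 2 / 2) *
        Real.exp (-lam * ‖u‖ ^ 2) := by
      rw [← Real.exp_add]; congr 1; ring
    rw [hF]; dsimp only; rw [e1, e2]; ring
  have i1 := integrable_complex_gaussian (b := lam - lam₂) (by linarith)
  have i2 := integrable_complex_gaussian (b := lam - lam₂ / 2) (by linarith)
  have i3 := integrable_complex_gaussian hlam
  have hFi : Integrable F := ((i1.sub (i2.const_mul 2)).add i3).const_mul 4
  have hFint : ∫ u, F u = 4 * (Real.pi / (lam - lam₂) - 2 * (Real.pi / (lam - lam₂ / 2)) +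
      Real.pi / lam) := by
    have i12 : Integrable fun z : ℂ ↦ Real.exp (-(lam - lam₂) * ‖z‖ ^ 2) -
      2 * Real.exp (-(lam - lam₂ / 2) * ‖z‖ ^ 2) := i1.sub (i2.const_mul 2)
    rw [hF, integral_const_mul, integral_add i12 i3,
      integral_sub i1 (i2.const_mul 2), integral_const_mul,
      integral_complex_gaussian (by linarith), integral_complex_gaussian (by linarith),
      integral_complex_gaussian hlam]
  calc _ ≤ ENNReal.ofReal (lam / Real.pi) * ∫⁻ u : ℂ, ENNReal.ofReal (F u) := by
        gcongr with u
        rw [hFe]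
        gcongr
        have := norm_prod_one_add_mul_exp_neg_sub_one_le Finset.univ (fun j ↦ (p j : ℂ) * u)
        refine this.trans_eq ?_
        simp only [norm_mul, mul_pow, Complex.norm_real, Real.norm_eq_abs, sq_abs]
        rw [← Finset.sum_mul, ← hlam₂]
    _ = ENNReal.ofReal (lam / Real.pi) * ENNReal.ofReal (∫ u, F u) := by
        rw [ofReal_integral_eq_lintegral_ofReal hFi]
        exact Filter.Eventually.of_forall fun u ↦ by
          simp only [hFe, Pi.zero_apply]; positivity
    _ = _ := by
        rw [← ENNReal.ofReal_mul (by positivity), hFint]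
        congr 1
        have h1 : lam - lam₂ ≠ 0 := by linarith
        have h2 : 2 * lam - lam₂ ≠ 0 := by linarith
        rw [show lam - lam₂ / 2 = (2 * lam - lam₂) / 2 by ring]
        generalize hd1 : lam - lam₂ = d₁ at h1
        generalize hd2 : 2 * lam - lam₂ = d₂ at h2
        field_simp
        rw [← hd1, ← hd2]
        ring

/-- The `χ²`-type sum of the difference between a finitely supported law with generating function
`∏ (1 + pⱼ (z - 1))` and the Poisson law. -/
theorem tsum_sq_sub_poisson_le {ι : Type*} [Fintype ι] (p : ι → ℝ) {lam lam₂ : ℝ}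
    (hlampos : 0 < lam) (hlam : lam = ∑ j, p j) (hlam₂ : lam₂ = ∑ j, p j ^ 2) (hlt : lam₂ < lam)
    (w : ℕ → ℝ)
    (hgen : ∀ z : ℂ, HasSum (fun k ↦ (w k : ℂ) * z ^ k) (∏ j, (1 + p j * (z - 1)))) :
    ∑' k : ℕ, ENNReal.ofReal ((w k - Real.exp (-lam) * lam ^ k / k.factorial) ^ 2 /
      (Real.exp (-lam) * lam ^ k / k.factorial)) ≤
      ENNReal.ofReal (4 * lam₂ ^ 2 / ((lam - lam₂) * (2 * lam - lam₂))) := by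
  set f : ℕ → ℂ := fun k ↦ ((w k - Real.exp (-lam) * lam ^ k / k.factorial : ℝ) : ℂ) with hf
  have hpois (z : ℂ) : HasSum (fun k ↦ ((Real.exp (-lam) * lam ^ k / k.factorial : ℝ) : ℂ) * z ^ k)
      (Complex.exp (lam * (z - 1))) := by
    have h := (NormedSpace.expSeries_div_hasSum_exp ((lam : ℂ) * z)).mul_left (Complex.exp (-lam))
    rw [← Complex.exp_eq_exp_ℂ, ← Complex.exp_add] at h
    convert! h using 1
    · funext k; push_cast; rw [mul_pow]; ring
    · congr 1; ring
  have hsum (z : ℂ) : HasSum (fun k ↦ f k * z ^ k)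
      (∏ j, (1 + p j * (z - 1)) - Complex.exp (lam * (z - 1))) := by
    convert! (hgen z).sub (hpois z) using 1
    funext k; simp only [hf]; push_cast; ring
  have hsummable (r : ℝ) (hr : 0 ≤ r) : Summable fun k ↦ ‖f k‖ * r ^ k := by
    have := (hsum r).summable.norm
    simpa [abs_of_nonneg hr] using this
  have hfock := tsum_factorial_eq_lintegral_gaussian hlampos hsummable
  have hterm (k : ℕ) : ENNReal.ofReal ((w k - Real.exp (-lam) * lam ^ k / k.factorial) ^ 2 /
      (Real.exp (-lam) * lam ^ k / k.factorial)) = ENNReal.ofReal (Real.exp lam) *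
      ENNReal.ofReal (‖f k‖ ^ 2 * (k.factorial / lam ^ k)) := by
    rw [← ENNReal.ofReal_mul (by positivity)]
    congr 1
    simp only [hf, Complex.norm_real, Real.norm_eq_abs, sq_abs]
    rw [Real.exp_neg]
    field_simp
  simp only [hterm]
  rw [ENNReal.tsum_mul_left, hfock]
  refine le_of_eq_of_le ?_ (lintegral_sq_norm_prod_sub_one_le p hlampos hlam₂ hlt)
  -- Translating by 1 and factoring out e^{λu}, the factor e^λ |e^{λu}|² exp(−λ|u+1|²) collapses to
  -- exp(−λ|u|²).
  rw [mul_left_comm, ← lintegral_const_mul' _ _ ENNReal.ofReal_ne_top,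
    ← lintegral_add_right_eq_self _ (1 : ℂ)]
  congr 1
  refine lintegral_congr fun u ↦ ?_
  rw [← ENNReal.ofReal_mul (by positivity), (hsum _).tsum_eq]
  congr 1
  simp only [add_sub_cancel_right]
  have hfac : ∏ j, (1 + (p j : ℂ) * u) - Complex.exp (lam * u) =
      Complex.exp (lam * u) * (∏ j, ((1 + p j * u) * Complex.exp (-(p j * u))) - 1) := by
    rw [Finset.prod_mul_distrib, ← Complex.exp_sum, Finset.sum_neg_distrib, ← Finset.sum_mul]
    have : ∑ j, (p j : ℂ) = lam := by rw [hlam]; push_cast; rfl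
    rw [this, mul_sub, mul_left_comm, ← Complex.exp_add]
    simp
  have hnorm : ‖u + 1‖ ^ 2 = ‖u‖ ^ 2 + 2 * u.re + 1 := by
    rw [Complex.sq_norm, Complex.sq_norm, Complex.normSq_apply, Complex.normSq_apply]
    simp; ring
  rw [hfac, norm_mul, mul_pow, Complex.norm_exp, hnorm, ← Real.exp_nat_mul]
  have : Real.exp (-lam * ‖u‖ ^ 2) = Real.exp lam * Real.exp ((2 : ℕ) * (lam * u).re) *
      Real.exp (-lam * (‖u‖ ^ 2 + 2 * u.re + 1)) := by
    rw [← Real.exp_add, ← Real.exp_add]; congr 1; simp; ring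
  rw [this]
  ring

/-! ### Divergences on ℕ as series. -/

theorem absolutelyContinuous_of_singleton_ne_zero {α : Type*} [MeasurableSpace α]
    (μ : Measure α) {ν : Measure α} (hν : ∀ k, ν {k} ≠ 0) : μ ≪ ν := by
  intro s hs
  have : s = ∅ := by
    by_contra h
    obtain ⟨k, hk⟩ := Set.nonempty_iff_ne_empty.2 h
    exact hν k (measure_mono_null (Set.singleton_subset_iff.2 hk) hs)
  simp [this]

theorem toReal_rnDeriv_eq_div (μ ν : Measure ℕ) [IsFiniteMeasure μ] [IsFiniteMeasure ν]
    (hν : ∀ k, ν {k} ≠ 0) (k : ℕ) :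
    (μ.rnDeriv ν k).toReal = μ.real {k} / ν.real {k} := by
  have h := Measure.setLIntegral_rnDeriv (absolutelyContinuous_of_singleton_ne_zero μ hν) {k}
  rw [lintegral_singleton] at h
  have hpos : ν.real {k} ≠ 0 := by
    rw [measureReal_def]; exact ENNReal.toReal_ne_zero.2 ⟨hν k, measure_ne_top _ _⟩
  rw [eq_div_iff hpos, measureReal_def, measureReal_def, ← h, ENNReal.toReal_mul]

theorem klDiv_eq_tsum (μ ν : Measure ℕ) [IsFiniteMeasure μ] [IsFiniteMeasure ν]
    (hν : ∀ k, ν {k} ≠ 0) :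
    InformationTheory.klDiv μ ν = ∑' k, ENNReal.ofReal
      (ν.real {k} * InformationTheory.klFun (μ.real {k} / ν.real {k})) := by
  rw [InformationTheory.klDiv_eq_lintegral_klFun_of_ac
    (absolutelyContinuous_of_singleton_ne_zero μ hν), lintegral_countable']
  refine tsum_congr fun k ↦ ?_
  rw [toReal_rnDeriv_eq_div μ ν hν, mul_comm, ENNReal.ofReal_mul measureReal_nonneg,
    ofReal_measureReal]

theorem chiSqDiv_eq_tsum (μ ν : Measure ℕ) [IsFiniteMeasure ν] (hν : ∀ k, ν {k} ≠ 0) :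
    chiSqDiv μ ν = ∑' k, ENNReal.ofReal ((μ.real {k} - ν.real {k}) ^ 2 / ν.real {k}) := by
  unfold chiSqDiv
  refine tsum_congr fun k ↦ ?_
  have hpos : 0 < ν.real {k} := by
    rw [measureReal_def]; exact ENNReal.toReal_pos (hν k) (measure_ne_top _ _)
  rw [ENNReal.ofReal_div_of_pos hpos, ofReal_measureReal]

/-- Insert log x ≤ x − 1 into x log x + 1 − x. -/
theorem klFun_le_sq {x : ℝ} (hx : 0 ≤ x) : InformationTheory.klFun x ≤ (x - 1) ^ 2 := by
  rw [InformationTheory.klFun_apply]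
  rcases hx.eq_or_lt with rfl | h
  · simp
  · nlinarith [Real.log_le_sub_one_of_pos h]

theorem klDiv_le_chiSqDiv (μ ν : Measure ℕ) [IsFiniteMeasure μ] [IsFiniteMeasure ν]
    (hν : ∀ k, ν {k} ≠ 0) : InformationTheory.klDiv μ ν ≤ chiSqDiv μ ν := by
  rw [klDiv_eq_tsum μ ν hν, chiSqDiv_eq_tsum μ ν hν]
  refine ENNReal.tsum_le_tsum fun k ↦ ENNReal.ofReal_le_ofReal ?_
  have hpos : 0 < ν.real {k} := by
    rw [measureReal_def]; exact ENNReal.toReal_pos (hν k) (measure_ne_top _ _)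
  calc _ ≤ ν.real {k} * (μ.real {k} / ν.real {k} - 1) ^ 2 := by
        gcongr
        exact klFun_le_sq (by positivity)
    _ = _ := by field_simp

/-- Fenchel's inequality for `klFun`. -/
theorem mul_sub_exp_le_klFun {x : ℝ} (hx : 0 ≤ x) (y : ℝ) :
    x * y + 1 - Real.exp y ≤ InformationTheory.klFun x := by
  rw [InformationTheory.klFun_apply]
  rcases hx.eq_or_lt with rfl | h
  · simp [Real.exp_nonneg]
  · have h1 := Real.add_one_le_exp (y - Real.log x)
    rw [Real.exp_sub, Real.exp_log h, le_div_iff₀ h] at h1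
    nlinarith

/-- The Donsker-Varadhan lower bound for a finitely supported first argument. -/
theorem le_klDiv_of_sum_exp_le (μ ν : Measure ℕ) [IsProbabilityMeasure μ] [IsProbabilityMeasure ν]
    (hν : ∀ k, ν {k} ≠ 0) (n : ℕ) (hμ : ∀ k ∉ Finset.range n, μ.real {k} = 0)
    (g : ℕ → ℝ) (B : ℝ)
    (hB : ∀ N, ∑ k ∈ Finset.range N, ν.real {k} * Real.exp (g k) ≤ Real.exp B) :
    ENNReal.ofReal (∑ k ∈ Finset.range n, μ.real {k} * g k - B) ≤
      InformationTheory.klDiv μ ν := by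
  have hsum (ρ : Measure ℕ) [IsProbabilityMeasure ρ] : HasSum (fun k ↦ ρ.real {k}) 1 := by
    have e : ∑' k, ρ {k} = 1 := by
      simpa using (lintegral_countable' (μ := ρ) (fun _ ↦ 1)).symm
    have h := ENNReal.hasSum_toReal (f := fun k ↦ ρ {k}) (by simp [e])
    simpa [← ENNReal.tsum_toReal_eq, e, measureReal_def] using h
  have hμ1 : ∑ k ∈ Finset.range n, μ.real {k} = 1 :=
    (hasSum_sum_of_ne_finset_zero hμ).unique (hsum μ)
  -- Truncation at N costs only the missing mass of ν, which vanishes as N → ∞.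
  have hlow (N : ℕ) (hN : n ≤ N) :
      ENNReal.ofReal (∑ k ∈ Finset.range n, μ.real {k} * g k - B +
        (∑ k ∈ Finset.range N, ν.real {k} - 1)) ≤ InformationTheory.klDiv μ ν := by
    have hext (h : ℕ → ℝ) : ∑ k ∈ Finset.range N, μ.real {k} * h k =
        ∑ k ∈ Finset.range n, μ.real {k} * h k := by
      symm
      refine Finset.sum_subset (Finset.range_subset_range.2 hN) fun k _ hk ↦ ?_
      rw [hμ k hk, zero_mul]
    have hfin : ∑ k ∈ Finset.range n, μ.real {k} * g k - B + (∑ k ∈ Finset.range N, ν.real {k} - 1) ≤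
        ∑ k ∈ Finset.range N, ν.real {k} *
          InformationTheory.klFun (μ.real {k} / ν.real {k}) := by
      -- Fenchel's inequality is used at y = g k − B, a normalisation under which the exponential
      -- sum is at most 1.
      calc _ ≤ ∑ k ∈ Finset.range N, μ.real {k} * (g k - B) + ∑ k ∈ Finset.range N, ν.real {k} -
            Real.exp (-B) * ∑ k ∈ Finset.range N, ν.real {k} * Real.exp (g k) := by
            have h1 := mul_le_mul_of_nonneg_left (hB N) (Real.exp_nonneg (-B))
            rw [← Real.exp_add, neg_add_cancel, Real.exp_zero] at h1
            rw [hext]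
            simp only [mul_sub, Finset.sum_sub_distrib, ← Finset.sum_mul, hμ1]
            linarith
        _ = ∑ k ∈ Finset.range N, ν.real {k} * (μ.real {k} / ν.real {k} * (g k - B) + 1 -
              Real.exp (g k - B)) := by
            rw [Finset.mul_sum, ← Finset.sum_add_distrib, ← Finset.sum_sub_distrib]
            refine Finset.sum_congr rfl fun k _ ↦ ?_
            have hpos : 0 < ν.real {k} := by
              rw [measureReal_def]; exact ENNReal.toReal_pos (hν k) (measure_ne_top _ _)
            rw [sub_eq_add_neg (g k), Real.exp_add]
            field_simp
        _ ≤ _ := by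
            gcongr
            exact mul_sub_exp_le_klFun (by positivity) _
    calc _ ≤ ENNReal.ofReal (∑ k ∈ Finset.range N, ν.real {k} *
          InformationTheory.klFun (μ.real {k} / ν.real {k})) := ENNReal.ofReal_le_ofReal hfin
      _ = ∑ k ∈ Finset.range N, ENNReal.ofReal (ν.real {k} *
          InformationTheory.klFun (μ.real {k} / ν.real {k})) :=
        ENNReal.ofReal_sum_of_nonneg fun k _ ↦ mul_nonneg measureReal_nonneg
          (InformationTheory.klFun_nonneg (by positivity))
      _ ≤ _ := by
        rw [klDiv_eq_tsum μ ν hν]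
        exact ENNReal.sum_le_tsum _
  have hlim : Filter.Tendsto (fun N ↦ ENNReal.ofReal (∑ k ∈ Finset.range n, μ.real {k} * g k - B +
        (∑ k ∈ Finset.range N, ν.real {k} - 1))) Filter.atTop
      (nhds (ENNReal.ofReal (∑ k ∈ Finset.range n, μ.real {k} * g k - B + (1 - 1)))) :=
    (ENNReal.continuous_ofReal.tendsto _).comp
      (((hsum ν).tendsto_sum_nat.sub_const 1).const_add _)
  rw [sub_self, add_zero] at hlim
  exact le_of_tendsto hlim (Filter.eventually_atTop.2 ⟨n, hlow⟩)

/-! ### Support, generating function and moments of the Bernoulli sum. -/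

section BernoulliSum

variable {Ω : Type*} [MeasurableSpace Ω] {P : Measure Ω}

theorem ae_le_one_of_hasLaw_bernoulli {Y : Ω → ℕ} {q : unitInterval}
    (hY : HasLaw Y (bernoulliMeasure 1 0 q) P) : ∀ᵐ ω ∂P, Y ω ≤ 1 := by
  rw [hY.ae_iff (p := fun k ↦ k ≤ 1) (by fun_prop), ae_iff,
    bernoulliMeasure_apply_of_notMem_of_notMem] <;> simp

theorem integral_comp_of_hasLaw_bernoulli {E : Type*} [NormedAddCommGroup E] [NormedSpace ℝ E]
    [CompleteSpace E] {Y : Ω → ℕ} {q : unitInterval}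
    (hY : HasLaw Y (bernoulliMeasure 1 0 q) P) (f : ℕ → E) :
    ∫ ω, f (Y ω) ∂P = (q : ℝ) • f 1 + (1 - q : ℝ) • f 0 := by
  rw [← integral_bernoulliMeasure]
  exact hY.integral_comp .of_discrete

variable {n : ℕ} {p : Fin n → unitInterval} {X : Fin n → Ω → ℕ} {W : Ω → ℕ}

theorem aemeasurable_bernoulliSum (hX : ∀ j, HasLaw (X j) (bernoulliMeasure 1 0 (p j)) P)
    (hW : ∀ ω, W ω = ∑ j, X j ω) : AEMeasurable W P := by
  rw [funext hW]
  exact Finset.aemeasurable_fun_sum _ fun j _ ↦ (hX j).aemeasurable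

theorem map_bernoulliSum_real_eq_zero (hX : ∀ j, HasLaw (X j) (bernoulliMeasure 1 0 (p j)) P)
    (hW : ∀ ω, W ω = ∑ j, X j ω) (k : ℕ) (hk : k ∉ Finset.range (n + 1)) :
    (P.map W).real {k} = 0 := by
  rw [map_measureReal_apply_of_aemeasurable (aemeasurable_bernoulliSum hX hW) (by simp),
    measureReal_def]
  suffices P (W ⁻¹' {k}) = 0 by simp [this]
  have h := ae_all_iff.2 fun j ↦ ae_le_one_of_hasLaw_bernoulli (hX j)
  refine measure_mono_null ?_ (ae_iff.1 h)
  intro ω hω hle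
  have h1 : W ω ≤ n := by
    rw [hW]
    exact (Finset.sum_le_sum fun j _ ↦ hle j).trans (by simp)
  simp only [Set.mem_preimage, Set.mem_singleton_iff] at hω
  simp at hk
  omega

variable [IsProbabilityMeasure P]

theorem sum_map_bernoulliSum_smul {E : Type*} [NormedAddCommGroup E] [NormedSpace ℝ E]
    [CompleteSpace E] (hX : ∀ j, HasLaw (X j) (bernoulliMeasure 1 0 (p j)) P)
    (hW : ∀ ω, W ω = ∑ j, X j ω) (f : ℕ → E) :
    ∑ k ∈ Finset.range (n + 1), (P.map W).real {k} • f k = ∫ ω, f (W ω) ∂P := by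
  have hWm := aemeasurable_bernoulliSum hX hW
  have := Measure.isProbabilityMeasure_map hWm
  have hzero := map_bernoulliSum_real_eq_zero hX hW
  have hint : Integrable f (P.map W) := by
    rw [← Measure.sum_smul_dirac (P.map W), integrable_sum_dirac_iff (fun _ ↦ measure_ne_top _ _)]
    refine summable_of_ne_finset_zero (s := Finset.range (n + 1)) fun k hk ↦ ?_
    have := hzero k hk
    rw [measureReal_def] at this
    rw [this, zero_mul]
  rw [← integral_map hWm .of_discrete, integral_countable hint]
  exact (tsum_eq_sum fun k hk ↦ by rw [hzero k hk, zero_smul]).symm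

/-- By independence E z^W factors over j; the series is finite because W ≤ n almost surely. -/
theorem hasSum_generating_bernoulliSum (hX : ∀ j, HasLaw (X j) (bernoulliMeasure 1 0 (p j)) P)
    (hindep : iIndepFun X P) (hW : ∀ ω, W ω = ∑ j, X j ω) (z : ℂ) :
    HasSum (fun k ↦ ((P.map W).real {k} : ℂ) * z ^ k) (∏ j, (1 + (p j : ℝ) * (z - 1))) := by
  have h := hindep.integral_fun_prod_comp (f := fun _ k ↦ z ^ k)
    (fun j ↦ (hX j).aemeasurable) (fun j ↦ .of_discrete)
  have h1 : ∏ j, (1 + ((p j : ℝ) : ℂ) * (z - 1)) =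
      ∑ k ∈ Finset.range (n + 1), ((P.map W).real {k} : ℂ) * z ^ k := by
    have h2 := sum_map_bernoulliSum_smul hX hW (fun k ↦ z ^ k)
    simp only [Complex.real_smul] at h2
    rw [h2]
    simp only [hW, ← Finset.prod_pow_eq_pow_sum]
    rw [h]
    refine Finset.prod_congr rfl fun j _ ↦ ?_
    rw [integral_comp_of_hasLaw_bernoulli (hX j) (fun k ↦ z ^ k)]
    simp
    ring
  rw [h1]
  refine hasSum_sum_of_ne_finset_zero fun k hk ↦ ?_
  rw [map_bernoulliSum_real_eq_zero hX hW k hk]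
  simp

theorem memLp_cast_of_hasLaw_bernoulli {Y : Ω → ℕ} {q : unitInterval}
    (hY : HasLaw Y (bernoulliMeasure 1 0 q) P) : MemLp (fun ω ↦ (Y ω : ℝ)) 2 P := by
  refine MemLp.of_bound (C := 1) ?_ ?_
  · exact (Measurable.of_discrete.comp_aemeasurable hY.aemeasurable).aestronglyMeasurable
  · filter_upwards [ae_le_one_of_hasLaw_bernoulli hY] with ω hω
    simpa using hω

theorem integral_bernoulliSum (hX : ∀ j, HasLaw (X j) (bernoulliMeasure 1 0 (p j)) P)
    (hW : ∀ ω, W ω = ∑ j, X j ω) : ∫ ω, (W ω : ℝ) ∂P = ∑ j, (p j : ℝ) := by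
  simp only [hW, Nat.cast_sum]
  rw [integral_finsetSum _ fun j _ ↦ (memLp_cast_of_hasLaw_bernoulli (hX j)).integrable (by simp)]
  refine Finset.sum_congr rfl fun j _ ↦ ?_
  rw [integral_comp_of_hasLaw_bernoulli (hX j) (fun k ↦ (k : ℝ))]
  simp

theorem integral_sq_bernoulliSum (hX : ∀ j, HasLaw (X j) (bernoulliMeasure 1 0 (p j)) P)
    (hindep : iIndepFun X P) (hW : ∀ ω, W ω = ∑ j, X j ω) :
    ∫ ω, (W ω : ℝ) ^ 2 ∂P =
      ∑ j, (p j : ℝ) - ∑ j, (p j : ℝ) ^ 2 + (∑ j, (p j : ℝ)) ^ 2 := by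
  have hL := fun j ↦ memLp_cast_of_hasLaw_bernoulli (hX j)
  have hWe : (fun ω ↦ (W ω : ℝ)) = ∑ j, fun ω ↦ (X j ω : ℝ) := by
    funext ω; simp [hW]
  have hWL : MemLp (fun ω ↦ (W ω : ℝ)) 2 P := by
    rw [hWe]; exact memLp_finsetSum' _ fun j _ ↦ hL j
  have hvar := IndepFun.variance_sum (s := Finset.univ) (fun j _ ↦ hL j)
    (fun i _ j _ hij ↦ (hindep.indepFun hij).comp (φ := fun k : ℕ ↦ (k : ℝ))
      (ψ := fun k : ℕ ↦ (k : ℝ)) .of_discrete .of_discrete)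
  rw [← hWe, variance_eq_sub hWL] at hvar
  have hX2 (j : Fin n) : variance (fun ω ↦ (X j ω : ℝ)) P = p j - (p j : ℝ) ^ 2 := by
    have h1 := integral_comp_of_hasLaw_bernoulli (hX j) (fun k ↦ (k : ℝ))
    have h2 := integral_comp_of_hasLaw_bernoulli (hX j) (fun k ↦ (k : ℝ) ^ 2)
    rw [variance_eq_sub (hL j)]
    simp only [Pi.pow_apply, h1, h2]
    simp
  rw [integral_bernoulliSum hX hW] at hvar
  simp only [hX2, Finset.sum_sub_distrib, Pi.pow_apply] at hvar
  linarith

end BernoulliSum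

/-! ### Assembly of the bounds. -/

theorem proposition6p2
    {Ω Ω' : Type*} [MeasurableSpace Ω] [MeasurableSpace Ω']
    (P : Measure Ω) [IsProbabilityMeasure P] (P' : Measure Ω') [IsProbabilityMeasure P']
    (n : ℕ) (p : Fin n → unitInterval)
    (X : Fin n → Ω → ℕ)
    (hX : ∀ j, HasLaw (X j) (bernoulliMeasure 1 0 (p j)) P)
    (hindep : iIndepFun X P)
    (W : Ω → ℕ) (hW : ∀ ω, W ω = ∑ j, X j ω)
    (lam lam₂ : ℝ) (hlam : lam = ∑ j, (p j : ℝ)) (hlam₂ : lam₂ = ∑ j, (p j : ℝ) ^ 2)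
    (Z : Ω' → ℕ) (hZ : HasLaw Z (poissonMeasure lam.toNNReal) P')
    (κ : ℝ) (hκ : κ ∈ Set.Ioo (0 : ℝ) 1)
    (hlam_ge : 1 / 2 ≤ lam) (hlam₂_le : lam₂ ≤ κ * lam) :
    ENNReal.ofReal (1 / 4 * (lam₂ / lam) ^ 2) ≤
        InformationTheory.klDiv (P.map W) (P'.map Z) ∧
      InformationTheory.klDiv (P.map W) (P'.map Z) ≤ chiSqDiv (P.map W) (P'.map Z) ∧
      chiSqDiv (P.map W) (P'.map Z) ≤
        ENNReal.ofReal (7 * 10 ^ 6 * ((1 - κ) ^ 3)⁻¹ * (lam₂ / lam) ^ 2) := by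
  obtain ⟨hκ0, hκ1⟩ := hκ
  have hlam0 : 0 < lam := by linarith
  have hlt : lam₂ < lam := by nlinarith
  have hlam₂0 : 0 ≤ lam₂ := by rw [hlam₂]; positivity
  have := Measure.isProbabilityMeasure_map (aemeasurable_bernoulliSum hX hW)
  rw [hZ.map_eq]
  have hνr (k : ℕ) : (poissonMeasure lam.toNNReal).real {k} =
      Real.exp (-lam) * lam ^ k / k.factorial := by
    rw [poissonMeasure_real_singleton, Real.coe_toNNReal _ hlam0.le]
  have hν (k : ℕ) : poissonMeasure lam.toNNReal {k} ≠ 0 := by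
    intro h
    have h1 := hνr k
    rw [measureReal_def, h, ENNReal.toReal_zero] at h1
    have : 0 < Real.exp (-lam) * lam ^ k / k.factorial := by positivity
    linarith
  refine ⟨?_, klDiv_le_chiSqDiv _ _ hν, ?_⟩
  · rcases hlam₂0.eq_or_lt with h0 | hpos
    · simp [← h0]
    -- This c maximises cλ₂/2 − c²λ²/4. The case λ₂ = 0 was split off because c must be positive; c
    -- ≤ 2 follows from λ₂ < λ and λ ≥ 1/2.
    set c := lam₂ / lam ^ 2 with hc
    have hc0 : 0 < c := by positivity
    have hc2 : c ≤ 2 := by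
      rw [hc, div_le_iff₀ (by positivity)]
      nlinarith
    have hDV := le_klDiv_of_sum_exp_le (P.map W) (poissonMeasure lam.toNNReal) hν (n + 1)
      (map_bernoulliSum_real_eq_zero hX hW)
      (fun k ↦ -(c / 2) * ((k : ℝ) ^ 2 - (2 * lam + 1) * k + lam ^ 2)) (c ^ 2 * lam ^ 2 / 4)
      (fun N ↦ by simp only [hνr]; exact sum_poisson_exp_charlier_le hlam0.le hc0 hc2 N)
    refine le_of_eq_of_le ?_ hDV
    congr 1
    have s0 := sum_map_bernoulliSum_smul hX hW (fun _ ↦ (1 : ℝ))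
    have s1 := sum_map_bernoulliSum_smul hX hW (fun k ↦ (k : ℝ))
    have s2 := sum_map_bernoulliSum_smul hX hW (fun k ↦ (k : ℝ) ^ 2)
    rw [integral_bernoulliSum hX hW, ← hlam] at s1
    rw [integral_sq_bernoulliSum hX hindep hW, ← hlam, ← hlam₂] at s2
    simp only [smul_eq_mul, mul_one, integral_const, probReal_univ] at s0 s1 s2
    have hsum : ∑ k ∈ Finset.range (n + 1), (P.map W).real {k} *
        (-(c / 2) * ((k : ℝ) ^ 2 - (2 * lam + 1) * k + lam ^ 2)) = c / 2 * lam₂ := by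
      calc _ = -(c / 2) * (∑ k ∈ Finset.range (n + 1), (P.map W).real {k} * (k : ℝ) ^ 2 -
            (2 * lam + 1) * ∑ k ∈ Finset.range (n + 1), (P.map W).real {k} * (k : ℝ) +
            lam ^ 2 * ∑ k ∈ Finset.range (n + 1), (P.map W).real {k}) := by
            rw [Finset.mul_sum (a := 2 * lam + 1), Finset.mul_sum (a := lam ^ 2),
              ← Finset.sum_sub_distrib, ← Finset.sum_add_distrib, Finset.mul_sum]
            refine Finset.sum_congr rfl fun k _ ↦ ?_
            ring
        _ = _ := by rw [s0, s1, s2]; ring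
    rw [hsum, hc]
    field_simp
    ring
  · rw [chiSqDiv_eq_tsum _ _ hν]
    simp only [hνr]
    refine (tsum_sq_sub_poisson_le (fun j ↦ (p j : ℝ)) hlam0 hlam hlam₂ hlt _
      (hasSum_generating_bernoulliSum hX hindep hW)).trans (ENNReal.ofReal_le_ofReal ?_)
    have h1κ : 0 < 1 - κ := by linarith
    -- Much is given away: the estimates h1 and h2 already give the factor 4/(1−κ) in place of
    -- 7·10⁶(1−κ)⁻³.
    have hd : (1 - κ) ^ 3 * lam ^ 2 ≤ (lam - lam₂) * (2 * lam - lam₂) := by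
      have h1 : (1 - κ) * lam ≤ lam - lam₂ := by linarith
      have h2 : lam ≤ 2 * lam - lam₂ := by linarith
      calc (1 - κ) ^ 3 * lam ^ 2 ≤ (1 - κ) ^ 1 * lam ^ 2 := by
            gcongr ?_ * _
            exact pow_le_pow_of_le_one h1κ.le (by linarith) (by norm_num)
        _ = ((1 - κ) * lam) * lam := by ring
        _ ≤ _ := by gcongr
    calc 4 * lam₂ ^ 2 / ((lam - lam₂) * (2 * lam - lam₂))
        ≤ 7 * 10 ^ 6 * lam₂ ^ 2 / ((1 - κ) ^ 3 * lam ^ 2) := by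
          gcongr
          norm_num
      _ = _ := by field_simp
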